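/- Let $K$ be an abstract simplicial complex on the vertex set $\{v_1,\dots,v_m\}$ (every $v_i$ being a vertex of $K$) and let $J=(j_1,\dots,j_m)$ be a sequence of positive integers; put $d(J)=j_1+\cdots+j_m$. A minimal non-face of a complex is a nonempty set of its vertices that is not a simplex although all its proper nonempty subsets are simplices. Let $K(J)$ be the simplicial complex on the $d(J)$ vertices $v_{ik}$ ($1\le i\le m$, $1\le k\le j_i$) whose minimal non-faces are exactly the sets $\{v_{ik} : v_i\in\tau,\ 1\le k\le j_i\}$ with $\tau$ a minimal non-face of $K$. A convex polytope of dimension $n$ is simple if each of its vertices lies in exactly $n$ facets (nonempty faces of dimension $n-1$). A simplicial complex is dual to a simple polytope if there is a bijection from its vertices onto the facets of the polytope such that a nonempty set of vertices is a simplex if and only if the corresponding facets have a common point. **Theorem.** If $K$ is dual to a simple polytope $P$ of dimension $n$ having $m$ facets, then $K(J)$ is dual to a simple polytope $P(J)$ of dimension $d(J)-m+n$ having $d(J)$ facets. -/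

import Mathlib

section Complexes

/-- A non-face of `K`: a nonempty set of vertices of `K` that does not span a simplex of `K`
(the faces of a Mathlib `AbstractSimplicialComplex` are its nonempty simplices). It is minimal if
every proper nonempty subset of it is a simplex of `K`. -/
def IsMinimalNonface {V : Type*} (K : AbstractSimplicialComplex V) (τ : Finset V) : Prop :=
  τ.Nonempty ∧ τ ∉ K ∧ ∀ ρ : Finset V, ρ ⊂ τ → ρ.Nonempty → ρ ∈ K

/-- The vertex set `{v_{i k} : 1 ≤ i ≤ m, 1 ≤ k ≤ j_i}` of `K(J)`. -/
abbrev MultiVertex {m : ℕ} (J : Fin m → ℕ+) : Type := Σ i : Fin m, Fin (J i : ℕ)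

/-- The set of all the copies `v_{i k}`, `1 ≤ k ≤ j_i`, of the vertices `v_i` in `τ`. -/
def inflate {m : ℕ} (J : Fin m → ℕ+) (τ : Finset (Fin m)) : Finset (MultiVertex J) :=
  τ.sigma fun _ => Finset.univ

/-- `d(J) = j_1 + ⋯ + j_m`. -/
def totalSize {m : ℕ} (J : Fin m → ℕ+) : ℕ := ∑ i, (J i : ℕ)

/-- The complex `K(J)`: its simplices are the sets of vertices that contain no set of the form
`inflate J τ` with `τ` a minimal non-face of `K`. That these sets are exactly its minimal
non-faces, and that this determines it, is `eq_multiComplex_iff`. -/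
def multiComplex {m : ℕ} (K : AbstractSimplicialComplex (Fin m)) (J : Fin m → ℕ+) :
    AbstractSimplicialComplex (MultiVertex J) where
  faces := {σ | σ.Nonempty ∧ ∀ τ, IsMinimalNonface K τ → ¬ inflate J τ ⊆ σ}
  isRelLowerSet_faces := fun _ hσ =>
    ⟨hσ.1, fun _ hρσ hρ => ⟨hρ, fun τ hτ h => hσ.2 τ hτ (h.trans hρσ)⟩⟩
  singleton_mem := by
    rintro ⟨i, k⟩
    refine ⟨Finset.singleton_nonempty _, fun τ hτ h => hτ.2.1 ?_⟩
    have hτi : τ = {i} := by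
      refine Finset.eq_singleton_iff_nonempty_unique_mem.2 ⟨hτ.1, fun x hx => ?_⟩
      have hmem : (⟨x, ⟨0, (J x).pos⟩⟩ : MultiVertex J) ∈ inflate J τ := by
        simp [inflate, hx]
      exact congrArg Sigma.fst (Finset.mem_singleton.1 (h hmem))
    rw [hτi]
    exact K.singleton_mem i

theorem exists_minimalNonface_subset {V : Type*} (K : AbstractSimplicialComplex V)
    (σ : Finset V) (hne : σ.Nonempty) (hσ : σ ∉ K) : ∃ τ ⊆ σ, IsMinimalNonface K τ := by
  induction σ using Finset.strongInduction with
  | H σ ih =>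
    by_cases h : ∀ ρ : Finset V, ρ ⊂ σ → ρ.Nonempty → ρ ∈ K
    · exact ⟨σ, subset_rfl, hne, hσ, h⟩
    · push Not at h
      obtain ⟨ρ, hρσ, hρ, hρK⟩ := h
      obtain ⟨τ, hτ, hmin⟩ := ih ρ hρσ hρ hρK
      exact ⟨τ, hτ.trans hρσ.subset, hmin⟩

theorem mem_iff_no_minimalNonface {V : Type*} (K : AbstractSimplicialComplex V) (σ : Finset V) :
    σ ∈ K ↔ σ.Nonempty ∧ ∀ τ, IsMinimalNonface K τ → ¬ τ ⊆ σ := by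
  constructor
  · intro hσ
    refine ⟨(K.isRelLowerSet_faces hσ).1, fun τ hτ h => hτ.2.1 ?_⟩
    exact (K.isRelLowerSet_faces hσ).2 h hτ.1
  · rintro ⟨hne, h⟩
    by_contra hσ
    obtain ⟨τ, hτ, hmin⟩ := exists_minimalNonface_subset K σ hne hσ
    exact h τ hmin hτ

theorem inflate_subset_inflate_iff {m : ℕ} (J : Fin m → ℕ+) (τ ρ : Finset (Fin m)) :
    inflate J τ ⊆ inflate J ρ ↔ τ ⊆ ρ := by
  constructor
  · intro h x hx
    have hmem : (⟨x, ⟨0, (J x).pos⟩⟩ : MultiVertex J) ∈ inflate J τ := by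
      simp [inflate, hx]
    simpa [inflate] using h hmem
  · exact fun h => Finset.sigma_mono h fun _ => subset_rfl

/-- `K(J)` is the unique complex on the vertices `v_{i k}` whose minimal non-faces are exactly the
sets of all copies of the vertices of a minimal non-face of `K`. -/
theorem eq_multiComplex_iff {m : ℕ} (K : AbstractSimplicialComplex (Fin m)) (J : Fin m → ℕ+)
    (L : AbstractSimplicialComplex (MultiVertex J)) :
    L = multiComplex K J ↔
      ∀ ρ, IsMinimalNonface L ρ ↔ ∃ τ, IsMinimalNonface K τ ∧ ρ = inflate J τ := by
  have key : ∀ σ, σ ∈ multiComplex K J ↔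
      σ.Nonempty ∧ ∀ τ, IsMinimalNonface K τ → ¬ inflate J τ ⊆ σ := fun σ => Iff.rfl
  constructor
  · rintro rfl ρ
    constructor
    · rintro ⟨hne, hρ, hmin⟩
      rw [key] at hρ
      push Not at hρ
      obtain ⟨τ, hτ, hsub⟩ := hρ hne
      refine ⟨τ, hτ, ?_⟩
      by_contra hneq
      have hin : (inflate J τ).Nonempty := by
        obtain ⟨x, hx⟩ := hτ.1
        exact ⟨⟨x, ⟨0, (J x).pos⟩⟩, by simp [inflate, hx]⟩
      have := hmin _ (Finset.ssubset_iff_subset_ne.2 ⟨hsub, Ne.symm hneq⟩) hin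
      exact ((key _).1 this).2 τ hτ subset_rfl
    · rintro ⟨τ, hτ, rfl⟩
      refine ⟨?_, fun h => ((key _).1 h).2 τ hτ subset_rfl, fun ρ hρ hne => (key _).2 ⟨hne, ?_⟩⟩
      · obtain ⟨x, hx⟩ := hτ.1
        exact ⟨⟨x, ⟨0, (J x).pos⟩⟩, by simp [inflate, hx]⟩
      · intro τ' hτ' hsub
        have h1 : τ' ⊆ τ := (inflate_subset_inflate_iff J _ _).1 (hsub.trans hρ.subset)
        have h2 : τ' ≠ τ := by
          rintro rfl
          exact hρ.2 hsub
        exact hτ'.2.1 (hτ.2.2 τ' (Finset.ssubset_iff_subset_ne.2 ⟨h1, h2⟩) hτ'.1)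
  · intro h
    refine SetLike.ext fun σ => ?_
    rw [mem_iff_no_minimalNonface, key]
    refine and_congr_right fun _ => ⟨fun H τ hτ => H _ ((h _).2 ⟨τ, hτ, rfl⟩), fun H ρ hρ => ?_⟩
    obtain ⟨τ, hτ, rfl⟩ := (h ρ).1 hρ
    exact H τ hτ

end Complexes

section Polytopes

/-- A (nonempty) convex polytope: the convex hull of a nonempty finite set of points. -/
def IsPolytope {N : ℕ} (P : Set (EuclideanSpace ℝ (Fin N))) : Prop :=
  ∃ s : Finset (EuclideanSpace ℝ (Fin N)), s.Nonempty ∧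
    P = convexHull ℝ (s : Set (EuclideanSpace ℝ (Fin N)))

/-- The dimension of (the affine hull of) a nonempty set of points. -/
noncomputable def polyDim {N : ℕ} (P : Set (EuclideanSpace ℝ (Fin N))) : ℕ :=
  Module.finrank ℝ (vectorSpan ℝ P)

/-- A facet of `P`: a nonempty face of dimension `dim P - 1`, the faces being the sets of maximum
points on `P` of the linear functionals. -/
def IsFacet {N : ℕ} (P F : Set (EuclideanSpace ℝ (Fin N))) : Prop :=
  F.Nonempty ∧ IsExposed ℝ P F ∧ polyDim F + 1 = polyDim P

/-- The set of all facets of `P`. -/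
def facets {N : ℕ} (P : Set (EuclideanSpace ℝ (Fin N))) :
    Set (Set (EuclideanSpace ℝ (Fin N))) :=
  {F | IsFacet P F}

/-- A simple polytope of dimension `n`: at each vertex exactly `n` facets intersect. -/
def IsSimplePolytope {N : ℕ} (n : ℕ) (P : Set (EuclideanSpace ℝ (Fin N))) : Prop :=
  IsPolytope P ∧ polyDim P = n ∧
    ∀ x ∈ Set.extremePoints ℝ P, {F ∈ facets P | x ∈ F}.encard = n

/-- `K` is dual to `P`: the vertices of `K` correspond bijectively to the facets of `P` in such a
way that a nonempty set of vertices spans a simplex of `K` if and only if the corresponding facets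
have a common point. -/
def IsDualTo {V : Type*} {N : ℕ} (K : AbstractSimplicialComplex V)
    (P : Set (EuclideanSpace ℝ (Fin N))) : Prop :=
  ∃ Φ : V ≃ facets P, ∀ σ : Finset V, σ.Nonempty →
    (σ ∈ K ↔ (⋂ v ∈ σ, (Φ v : Set (EuclideanSpace ℝ (Fin N)))).Nonempty)

end Polytopes

open Filter Topology

/-! Let `a i = c i + b i` be affine functions, nonnegative on `P`, whose zero sets on `P` are the
facets. Then `P(J)` is the set of pairs `(x, y)` with `x ∈ P`, `y ≥ 0` and `a i x = ∑ k, y ⟨i, k⟩`.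
These are `m` independent equations, so the dimension is `d(J) - m + n`.

The facets are the walls `y κ = 0`. A further facet would contain a point with all `y κ > 0`; a
functional maximal there descends to `P` and must be constant (`map_eq_of_forall_pos`), because
every point of a proper exposed face of `P` lies on a facet (`exists_facet_mem`).

At an extreme point, `x` is extreme in `P` and each `i` has at most one nonzero copy, which exists
iff `a i x ≠ 0`. So `m - n` coordinates are nonzero and `d(J) - m + n` vanish, which is simplicity.

The walls in `σ` meet iff some `x ∈ P` satisfies `a i x = 0` for each `i` all of whose copies lie in
`σ`: otherwise a copy outside `σ` can absorb `a i x`. This is the simplex condition of `K(J)`. -/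

theorem eventually_add_smul_mem_of_mem_intrinsicInterior {E : Type*} [NormedAddCommGroup E]
    [NormedSpace ℝ E] {s : Set E} {x w : E} (hx : x ∈ intrinsicInterior ℝ s)
    (hw : w ∈ vectorSpan ℝ s) : ∀ᶠ t : ℝ in 𝓝[>] 0, x + t • w ∈ s := by
  obtain ⟨x', hx', rfl⟩ := hx
  have hmem : ∀ t : ℝ, (x' : E) + t • w ∈ affineSpan ℝ s := fun t => by
    rw [add_comm]
    exact AffineSubspace.vadd_mem_of_mem_direction
      (by rw [direction_affineSpan]; exact Submodule.smul_mem _ t hw) x'.2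
  let f : ℝ → affineSpan ℝ s := fun t => ⟨x' + t • w, hmem t⟩
  have hf : Continuous f := by
    refine Continuous.subtype_mk ?_ _
    fun_prop
  have hf0 : f 0 = x' := Subtype.ext (by simp [f])
  have h : ∀ᶠ t in 𝓝 (0 : ℝ), f t ∈ interior ((↑) ⁻¹' s : Set (affineSpan ℝ s)) :=
    hf.continuousAt.eventually_mem (isOpen_interior.mem_nhds (by rwa [hf0]))
  exact (h.filter_mono nhdsWithin_le_nhds).mono fun t ht =>
    interior_subset (s := ((↑) ⁻¹' s : Set (affineSpan ℝ s))) ht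

theorem map_eq_zero_of_mem_vectorSpan {E : Type*} [AddCommGroup E] [Module ℝ E] {s : Set E}
    {l : E →ₗ[ℝ] ℝ} {c : ℝ} (h : ∀ x ∈ s, l x = c) {w : E} (hw : w ∈ vectorSpan ℝ s) :
    l w = 0 := by
  have : vectorSpan ℝ s ≤ LinearMap.ker l := by
    refine Submodule.span_le.2 ?_
    rintro _ ⟨x, hx, y, hy, rfl⟩
    simp [h x hx, h y hy]
  exact this hw

/-! ### Facets of a polytope -/

section Facets

variable {N : ℕ} {P F G : Set (EuclideanSpace ℝ (Fin N))}

theorem IsPolytope.isCompact (hP : IsPolytope P) : IsCompact P := by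
  obtain ⟨s, -, rfl⟩ := hP
  exact s.finite_toSet.isCompact_convexHull (𝕜 := ℝ)

theorem IsPolytope.convex (hP : IsPolytope P) : Convex ℝ P := by
  obtain ⟨s, -, rfl⟩ := hP
  exact convex_convexHull ℝ _

theorem IsPolytope.finite_extremePoints (hP : IsPolytope P) :
    (Set.extremePoints ℝ P).Finite := by
  obtain ⟨s, -, rfl⟩ := hP
  exact s.finite_toSet.subset extremePoints_convexHull_subset

theorem IsFacet.subset (hF : IsFacet P F) : F ⊆ P := hF.2.1.subset

theorem IsFacet.exists_notMem (hF : IsFacet P F) : ∃ p ∈ P, p ∉ F := by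
  by_contra! h
  have := hF.2.2
  rw [hF.subset.antisymm h] at this
  omega

theorem IsFacet.exists_functional (hF : IsFacet P F) :
    ∃ (b : EuclideanSpace ℝ (Fin N) →L[ℝ] ℝ) (c : ℝ),
      (∀ x ∈ P, 0 ≤ c + b x) ∧ F = {x ∈ P | c + b x = 0} := by
  obtain ⟨⟨x₀, hx₀⟩, hex, -⟩ := hF
  obtain ⟨l, rfl⟩ := hex ⟨x₀, hx₀⟩
  refine ⟨-l, l x₀, fun x hx => ?_, ?_⟩
  · simpa using hx₀.2 x hx
  · ext x
    simp only [Set.mem_ofPred_eq, neg_apply]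
    refine and_congr_right fun hx => ⟨fun h => ?_, fun h y hy => ?_⟩
    · linarith [h x₀ hx₀.1, hx₀.2 x hx]
    · linarith [hx₀.2 y hy]

/-- Equal dimensions force equal directions, and the affine function that cuts out `F` is constant
along them. -/
theorem IsFacet.eq_of_subset (hF : IsFacet P F) (hG : IsFacet P G) (h : F ⊆ G) : F = G := by
  obtain ⟨b, c, -, hFb⟩ := hF.exists_functional
  obtain ⟨x, hx⟩ := hF.1
  have hspan : vectorSpan ℝ F = vectorSpan ℝ G := by
    refine Submodule.eq_of_le_of_finrank_le (vectorSpan_mono ℝ h) ?_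
    have h1 := hF.2.2
    have h2 := hG.2.2
    simp only [polyDim] at h1 h2
    omega
  refine h.antisymm fun y hy => ?_
  have hyx : y - x ∈ vectorSpan ℝ F := hspan ▸ vsub_mem_vectorSpan ℝ hy (h hx)
  have h0 : (b : EuclideanSpace ℝ (Fin N) →ₗ[ℝ] ℝ) (y - x) = 0 := by
    refine map_eq_zero_of_mem_vectorSpan (c := -c) (fun z hz => ?_) hyx
    rw [hFb] at hz
    have := hz.2
    simp only [ContinuousLinearMap.coe_coe]
    linarith
  rw [hFb] at hx ⊢
  refine ⟨hG.subset hy, ?_⟩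
  have := hx.2
  simp only [ContinuousLinearMap.coe_coe, map_sub] at h0
  linarith

theorem IsFacet.mem_vectorSpan (hF : IsFacet P F) {b : EuclideanSpace ℝ (Fin N) →L[ℝ] ℝ} {c : ℝ}
    (hb : F = {x ∈ P | c + b x = 0}) {w : EuclideanSpace ℝ (Fin N)} (hw : w ∈ vectorSpan ℝ P)
    (hbw : b w = 0) : w ∈ vectorSpan ℝ F := by
  let K := vectorSpan ℝ P ⊓ LinearMap.ker (b : EuclideanSpace ℝ (Fin N) →ₗ[ℝ] ℝ)
  have hle : vectorSpan ℝ F ≤ K := by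
    refine le_inf (vectorSpan_mono ℝ hF.subset) fun v hv => ?_
    refine map_eq_zero_of_mem_vectorSpan (c := -c) (fun z hz => ?_) hv
    rw [hb] at hz
    have := hz.2
    simp only [ContinuousLinearMap.coe_coe]
    linarith
  -- `b` is not constant on `P`, so `K` is a proper subspace; codimension one of `F` then leaves no
  -- room between `vectorSpan ℝ F` and `K`.
  have hlt : K < vectorSpan ℝ P := by
    refine lt_of_le_of_ne inf_le_left fun hK => ?_
    obtain ⟨p, hp, hpF⟩ := hF.exists_notMem
    obtain ⟨x, hx⟩ := hF.1
    have hpx : p - x ∈ K := hK ▸ vsub_mem_vectorSpan ℝ hp (hF.subset hx)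
    have h0 := hpx.2
    rw [hb] at hx
    have := hx.2
    simp only [SetLike.mem_coe, LinearMap.mem_ker, ContinuousLinearMap.coe_coe, map_sub] at h0
    exact hpF (by rw [hb]; exact ⟨hp, by linarith⟩)
  have heq : vectorSpan ℝ F = K := by
    refine Submodule.eq_of_le_of_finrank_le hle ?_
    have h1 := Submodule.finrank_lt_finrank_of_lt hlt
    have h2 := hF.2.2
    simp only [polyDim] at h2
    omega
  rw [heq]
  exact ⟨hw, hbw⟩

/-- Rotating a supporting hyperplane of a polytope about a face of codimension at least two yields
a supporting hyperplane that cuts out a larger proper face. -/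
theorem exists_functional_face_lt {s : Finset (EuclideanSpace ℝ (Fin N))}
    (hP : P = convexHull ℝ (s : Set (EuclideanSpace ℝ (Fin N)))) {x p : EuclideanSpace ℝ (Fin N)}
    (hx : x ∈ P) {l : EuclideanSpace ℝ (Fin N) →ₗ[ℝ] ℝ} (hl : ∀ y ∈ P, l y ≤ l x)
    (hlp : l p < l x) (hdim : polyDim {y ∈ P | l y = l x} + 1 < polyDim P) :
    ∃ l' : EuclideanSpace ℝ (Fin N) →ₗ[ℝ] ℝ, (∀ y ∈ P, l' y ≤ l' x) ∧ l' p < l' x ∧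
      polyDim {y ∈ P | l y = l x} < polyDim {y ∈ P | l' y = l' x} := by
  set F : Set (EuclideanSpace ℝ (Fin N)) := {y ∈ P | l y = l x} with hF
  have hxF : x ∈ F := ⟨hx, rfl⟩
  obtain ⟨w, hwP, hw⟩ : ∃ w ∈ vectorSpan ℝ P, w ∉ vectorSpan ℝ F ⊔ Submodule.span ℝ {p - x} := by
    by_contra! h
    have h1 : vectorSpan ℝ P ≤ vectorSpan ℝ F ⊔ Submodule.span ℝ {p - x} := h
    have h2 := Submodule.finrank_mono h1
    have h3 := Submodule.finrank_add_le_finrank_add_finrank (vectorSpan ℝ F)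
      (Submodule.span ℝ {p - x})
    have h4 := finrank_span_le_card (R := ℝ) ({p - x} : Set (EuclideanSpace ℝ (Fin N)))
    rw [Set.toFinset_singleton, Finset.card_singleton] at h4
    simp only [polyDim] at hdim
    omega
  -- Adding a multiple of such a functional to `l` keeps `F` on the hyperplane and `p` strictly
  -- below it.
  obtain ⟨g₀, hg₀w, hg₀⟩ := Submodule.exists_le_ker_of_notMem hw
  obtain ⟨g, v, hv, hgv, hg⟩ : ∃ (g : EuclideanSpace ℝ (Fin N) →ₗ[ℝ] ℝ), ∃ v ∈ s, g x < g v ∧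
      vectorSpan ℝ F ⊔ Submodule.span ℝ {p - x} ≤ LinearMap.ker g := by
    obtain ⟨v, hv, hne⟩ : ∃ v ∈ s, g₀ v ≠ g₀ x := by
      by_contra! h
      refine hg₀w (map_eq_zero_of_mem_vectorSpan (s := (s : Set _)) h ?_)
      rwa [← direction_affineSpan, ← affineSpan_convexHull, ← hP, direction_affineSpan]
    rcases lt_or_gt_of_ne hne with h | h
    · exact ⟨-g₀, v, hv, by simpa using h, fun y hy => by simpa using hg₀ hy⟩
    · exact ⟨g₀, v, hv, h, hg₀⟩
  have hgp : g p = g x := by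
    have : p - x ∈ LinearMap.ker g :=
      hg (Submodule.mem_sup_right (Submodule.mem_span_singleton_self _))
    simpa [sub_eq_zero] using this
  have hgF : ∀ y ∈ F, g y = g x := fun y hy => by
    have : y - x ∈ LinearMap.ker g :=
      hg (Submodule.mem_sup_left (vsub_mem_vectorSpan ℝ hy hxF))
    simpa [sub_eq_zero] using this
  have hsP : ∀ u ∈ s, u ∈ P := fun u hu => hP ▸ subset_convexHull ℝ _ hu
  -- The rotation stops at the first generator `u` that the hyperplane of `l + t • g` meets; only
  -- generators with `g x < g u` can obstruct it.
  obtain ⟨u, hu, hmin⟩ := Finset.exists_min_image {u ∈ s | g x < g u}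
    (fun u => (l x - l u) / (g u - g x)) ⟨v, by simp [hv, hgv]⟩
  rw [Finset.mem_filter] at hu
  set t := (l x - l u) / (g u - g x) with ht
  have ht0 : 0 ≤ t := div_nonneg (by linarith [hl u (hsP u hu.1)]) (by linarith [hu.2])
  have htu : t * (g u - g x) = l x - l u := div_mul_cancel₀ _ (by linarith [hu.2])
  let l' := l + t • g
  have hl' : ∀ y, l' y = l y + t * g y := fun y => by simp [l']
  have hmax : ∀ y ∈ P, l' y ≤ l' x := by
    have hs : (s : Set (EuclideanSpace ℝ (Fin N))) ⊆ {y | l' y ≤ l' x} := fun y hy => by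
      rw [Set.mem_ofPred_eq, hl', hl']
      rcases lt_or_ge (g x) (g y) with h | h
      · have h1 := hmin y (by simp [Finset.mem_coe.1 hy, h])
        rw [le_div_iff₀ (by linarith)] at h1
        linarith
      · nlinarith [hl y (hsP y hy)]
    rw [hP]
    exact convexHull_min hs (convex_halfSpace_le l'.isLinear _)
  refine ⟨l', hmax, by rw [hl', hl', hgp]; linarith, ?_⟩
  refine Submodule.finrank_lt_finrank_of_lt (lt_of_le_of_ne (vectorSpan_mono ℝ ?_) fun h => ?_)
  · exact fun y hy => ⟨hy.1, by rw [hl', hl', hgF y hy, hy.2]⟩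
  · have huF' : u ∈ {y ∈ P | l' y = l' x} := ⟨hsP u hu.1, by rw [hl', hl']; linarith⟩
    have hmem : u - x ∈ vectorSpan ℝ F := h ▸ vsub_mem_vectorSpan ℝ huF' ⟨hx, rfl⟩
    have := map_eq_zero_of_mem_vectorSpan hgF hmem
    rw [map_sub] at this
    linarith [hu.2]

/-- Rotation enlarges the exposed face through `x` until its codimension is one; the point `p`,
always strictly below the maximum, keeps the face proper. -/
theorem IsPolytope.exists_facet_mem (hP : IsPolytope P) {x p : EuclideanSpace ℝ (Fin N)}
    (hx : x ∈ P) (hp : p ∈ P) {l : EuclideanSpace ℝ (Fin N) →ₗ[ℝ] ℝ} (hl : ∀ y ∈ P, l y ≤ l x)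
    (hlp : l p < l x) : ∃ F, IsFacet P F ∧ x ∈ F := by
  obtain ⟨s, -, hs⟩ := hP
  induction hk : polyDim P - polyDim {y ∈ P | l y = l x} using Nat.strong_induction_on
    generalizing l with
  | _ k ih =>
    have hlt : polyDim {y ∈ P | l y = l x} < polyDim P := by
      refine Submodule.finrank_lt_finrank_of_lt
        (lt_of_le_of_ne (vectorSpan_mono ℝ (Set.sep_subset _ _)) fun h => ?_)
      have hmem : p - x ∈ vectorSpan ℝ {y ∈ P | l y = l x} := h ▸ vsub_mem_vectorSpan ℝ hp hx
      have := map_eq_zero_of_mem_vectorSpan (fun y hy => hy.2) hmem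
      rw [map_sub] at this
      linarith
    by_cases hdim : polyDim {y ∈ P | l y = l x} + 1 < polyDim P
    · obtain ⟨l', h1, h2, h3⟩ := exists_functional_face_lt hs hx hl hlp hdim
      exact ih _ (by omega) h1 h2 rfl
    · refine ⟨{y ∈ P | l y = l x}, ⟨⟨x, hx, rfl⟩, fun _ => ⟨LinearMap.toContinuousLinearMap l, ?_⟩,
        by omega⟩, hx, rfl⟩
      ext y
      simp only [Set.mem_ofPred_eq, LinearMap.coe_toContinuousLinearMap']
      refine and_congr_right fun hy => ⟨fun h z hz => h ▸ hl z hz, fun h => ?_⟩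
      exact (hl y hy).antisymm (h x hx)

end Facets

/-- A compact convex set `P` together with affine functions `c i + b i`, nonnegative on `P`, which
cut out the facets of `P` in such a way that every extreme point lies in exactly `n` of them. The
fields `core`, `facet_core` and `support` record what is needed about the relative interiors of
`P` and of its facets. -/
structure FacetData {N : ℕ} (m n : ℕ) (P : Set (EuclideanSpace ℝ (Fin N))) where
  b : Fin m → EuclideanSpace ℝ (Fin N) →L[ℝ] ℝ
  c : Fin m → ℝ
  isCompact : IsCompact P
  convex : Convex ℝ P
  finite_extremePoints : (Set.extremePoints ℝ P).Finite
  dim : polyDim P = n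
  nonneg : ∀ i, ∀ x ∈ P, 0 ≤ c i + b i x
  card_extreme : ∀ x ∈ Set.extremePoints ℝ P, {i | c i + b i x = 0}.encard = n
  core : ∃ x ∈ P, (∀ i, 0 < c i + b i x) ∧
    ∀ w ∈ vectorSpan ℝ P, ∀ᶠ t : ℝ in 𝓝[>] 0, x + t • w ∈ P
  facet_core : ∀ i, ∃ x ∈ P, c i + b i x = 0 ∧ (∀ j ≠ i, 0 < c j + b j x) ∧
    ∀ w ∈ vectorSpan ℝ P, b i w = 0 → ∀ᶠ t : ℝ in 𝓝[>] 0, x + t • w ∈ P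
  support : ∀ x ∈ P, (∀ i, 0 < c i + b i x) → ∀ l : EuclideanSpace ℝ (Fin N) →ₗ[ℝ] ℝ,
    (∀ p ∈ P, l p ≤ l x) → ∀ p ∈ P, l p = l x

/-! ### From a simple polytope to its facet inequalities -/

section Extraction

variable {N n m : ℕ} {P : Set (EuclideanSpace ℝ (Fin N))}

/-- An affine function that is nonnegative on a convex set and not identically zero on it is
positive at the points of its relative interior. -/
theorem pos_of_mem_intrinsicInterior {x p : EuclideanSpace ℝ (Fin N)}
    {b : EuclideanSpace ℝ (Fin N) →L[ℝ] ℝ} {c : ℝ} (hb : ∀ y ∈ P, 0 ≤ c + b y)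
    (hx : x ∈ intrinsicInterior ℝ P) (hp : p ∈ P) (hbp : 0 < c + b p) : 0 < c + b x := by
  have hxP := intrinsicInterior_subset hx
  by_contra h
  have h0 : c + b x = 0 := le_antisymm (not_lt.1 h) (hb x hxP)
  obtain ⟨t, htP, ht⟩ := ((eventually_add_smul_mem_of_mem_intrinsicInterior hx
    (vsub_mem_vectorSpan ℝ hxP hp)).and self_mem_nhdsWithin).exists
  have h1 := hb _ htP
  simp only [vsub_eq_sub, map_add, map_smul, map_sub, smul_eq_mul] at h1
  replace ht : 0 < t := ht
  nlinarith

/-- Relative interior points of `P` and of each facet give `core` and `facet_core`; `support` is the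
contrapositive of `exists_facet_mem`. -/
theorem IsSimplePolytope.exists_facetData (hP : IsSimplePolytope n P) (Φ : Fin m ≃ facets P) :
    ∃ A : FacetData m n P, ∀ i, (Φ i : Set (EuclideanSpace ℝ (Fin N))) =
      {x ∈ P | A.c i + A.b i x = 0} := by
  obtain ⟨hpoly, hdim, hsimple⟩ := hP
  have hfacet : ∀ i, IsFacet P (Φ i) := fun i => (Φ i).2
  choose b c hnonneg hΦ using fun i => (hfacet i).exists_functional
  have hne : P.Nonempty := by
    obtain ⟨s, hs, rfl⟩ := hpoly
    exact (Finset.coe_nonempty.2 hs).convexHull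
  have hmem : ∀ {i x}, x ∈ P → (x ∈ (Φ i : Set (EuclideanSpace ℝ (Fin N))) ↔ c i + b i x = 0) := by
    intro i x hx
    rw [hΦ i]
    exact ⟨fun h => h.2, fun h => ⟨hx, h⟩⟩
  have hpos : ∀ {i x}, x ∈ P → x ∉ (Φ i : Set (EuclideanSpace ℝ (Fin N))) → 0 < c i + b i x :=
    fun {i x} hx h => lt_of_le_of_ne (hnonneg i x hx) fun h0 => h ((hmem hx).2 h0.symm)
  refine ⟨⟨b, c, hpoly.isCompact, hpoly.convex, hpoly.finite_extremePoints, hdim, hnonneg,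
    fun x hx => ?_, ?_, fun i => ?_, fun x hx hbx l hl p hp => ?_⟩, hΦ⟩
  · rw [← hsimple x hx]
    refine Set.encard_congr (Equiv.ofBijective (fun i => ⟨Φ i.1, (Φ i.1).2, ?_⟩) ⟨?_, ?_⟩)
    · exact (hmem hx.1).2 i.2
    · intro i j hij
      have h : (Φ i.1).1 = (Φ j.1).1 := congrArg (fun F => F.1) hij
      exact Subtype.ext (Φ.injective (Subtype.ext h))
    · rintro ⟨F, hF, hxF⟩
      obtain ⟨i, hi⟩ := Φ.surjective ⟨F, hF⟩
      have hi' : (Φ i : Set (EuclideanSpace ℝ (Fin N))) = F := congrArg Subtype.val hi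
      exact ⟨⟨i, (hmem hx.1).1 (hi' ▸ hxF)⟩, Subtype.ext hi'⟩
  · obtain ⟨x, hx⟩ := hne.intrinsicInterior hpoly.convex
    refine ⟨x, intrinsicInterior_subset hx, fun i => ?_, fun w hw =>
      eventually_add_smul_mem_of_mem_intrinsicInterior hx hw⟩
    obtain ⟨p, hp, hpF⟩ := (hfacet i).exists_notMem
    exact pos_of_mem_intrinsicInterior (hnonneg i) hx hp (hpos hp hpF)
  · have hconv : Convex ℝ (Φ i : Set (EuclideanSpace ℝ (Fin N))) :=
      (hfacet i).2.1.convex hpoly.convex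
    obtain ⟨x, hx⟩ := (hfacet i).1.intrinsicInterior hconv
    have hxF := intrinsicInterior_subset hx
    have hxP := (hfacet i).subset hxF
    refine ⟨x, hxP, (hmem hxP).1 hxF, fun j hj => ?_, fun w hw hbw => ?_⟩
    · obtain ⟨p, hp, hpj⟩ : ∃ p ∈ (Φ i : Set (EuclideanSpace ℝ (Fin N))),
          p ∉ (Φ j : Set (EuclideanSpace ℝ (Fin N))) := by
        by_contra! h
        exact hj (Φ.injective (Subtype.ext ((hfacet i).eq_of_subset (hfacet j) h))).symm
      exact pos_of_mem_intrinsicInterior (fun y hy => hnonneg j y ((hfacet i).subset hy)) hx hp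
        (hpos ((hfacet i).subset hp) hpj)
    · exact (eventually_add_smul_mem_of_mem_intrinsicInterior hx
        ((hfacet i).mem_vectorSpan (hΦ i) hw hbw)).mono fun t ht => (hfacet i).subset ht
  · refine (hl p hp).antisymm (not_lt.1 fun hlt => ?_)
    obtain ⟨F, hF, hxF⟩ := hpoly.exists_facet_mem hx hp hl hlt
    obtain ⟨i, hi⟩ := Φ.surjective ⟨F, hF⟩
    have hi' : (Φ i : Set (EuclideanSpace ℝ (Fin N))) = F := congrArg Subtype.val hi
    exact (hbx i).ne' ((hmem hx).1 (hi' ▸ hxF))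

end Extraction

/-! ### Distributing values among copies -/

section Weights

variable {m : ℕ} {J : Fin m → ℕ+}

theorem card_multiVertex (J : Fin m → ℕ+) : Fintype.card (MultiVertex J) = totalSize J := by
  simp [totalSize]

theorem le_totalSize (J : Fin m → ℕ+) : m ≤ totalSize J := by
  calc m = ∑ _i : Fin m, 1 := by simp
    _ ≤ totalSize J := Finset.sum_le_sum fun i _ => (J i).pos

/-- The copies of `i` outside `σ` receive equal shares of the unit; if there are none, no
normalization is possible. -/
theorem exists_weights (σ : Finset (MultiVertex J)) :
    ∃ r : MultiVertex J → ℝ, (∀ κ ∈ σ, r κ = 0) ∧ (∀ κ ∉ σ, 0 < r κ) ∧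
      ∀ i, (∃ k, ⟨i, k⟩ ∉ σ) → ∑ k, r ⟨i, k⟩ = 1 := by
  have hq : ∀ i, (∃ k, (⟨i, k⟩ : MultiVertex J) ∉ σ) →
      (0 : ℝ) < (Finset.univ.filter fun k => (⟨i, k⟩ : MultiVertex J) ∉ σ).card := by
    rintro i ⟨k, hk⟩
    exact Nat.cast_pos.2 (Finset.card_pos.2 ⟨k, by simp [hk]⟩)
  refine ⟨fun κ => if κ ∈ σ then 0 else
    ((Finset.univ.filter fun k => (⟨κ.1, k⟩ : MultiVertex J) ∉ σ).card : ℝ)⁻¹,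
    fun κ hκ => if_pos hκ, fun κ hκ => ?_, fun i hi => ?_⟩
  · simpa only [if_neg hκ] using inv_pos.2 (hq κ.1 ⟨κ.2, hκ⟩)
  · have h : ∀ k, (if (⟨i, k⟩ : MultiVertex J) ∈ σ then (0 : ℝ) else
        ((Finset.univ.filter fun k => (⟨i, k⟩ : MultiVertex J) ∉ σ).card : ℝ)⁻¹) =
        if (⟨i, k⟩ : MultiVertex J) ∉ σ then
          ((Finset.univ.filter fun k => (⟨i, k⟩ : MultiVertex J) ∉ σ).card : ℝ)⁻¹ else 0 :=
      fun k => by rw [ite_not]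
    rw [Finset.sum_congr rfl fun k _ => h k, ← Finset.sum_filter, Finset.sum_const, nsmul_eq_mul]
    exact mul_inv_cancel₀ (hq i hi).ne'

theorem mem_vectorSpan_of_eventually {E : Type*} [NormedAddCommGroup E] [NormedSpace ℝ E]
    {s : Set E} {z v : E} (hz : z ∈ s) (h : ∀ᶠ t : ℝ in 𝓝[>] 0, z + t • v ∈ s) :
    v ∈ vectorSpan ℝ s := by
  obtain ⟨t, ht, ht0⟩ := (h.and self_mem_nhdsWithin).exists
  have h1 := vsub_mem_vectorSpan ℝ ht hz
  rw [vsub_eq_sub, add_sub_cancel_left] at h1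
  exact (Submodule.smul_mem_iff _ (ne_of_gt ht0)).1 h1

theorem eventually_nonneg_add_mul {a : ℝ} (ha : 0 < a) (u : ℝ) :
    ∀ᶠ t : ℝ in 𝓝[>] 0, 0 ≤ a + t * u := by
  have h : ContinuousAt (fun t : ℝ => a + t * u) 0 := by fun_prop
  have h' := h.eventually_mem (Ici_mem_nhds (a := 0) (b := a + 0 * u) (by simpa using ha))
  exact h'.filter_mono nhdsWithin_le_nhds

end Weights

/-- An affine chart `z ↦ (x₀, y₀) + L z` of the space of all `(x, y)` with `x` in the affine span
of `P` and `c i + b i x = ∑ k, y ⟨i, k⟩` for every `i`. -/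
structure BlowUp {N m n : ℕ} {P : Set (EuclideanSpace ℝ (Fin N))} (A : FacetData m n P)
    (J : Fin m → ℕ+) (D : ℕ) where
  x₀ : EuclideanSpace ℝ (Fin N)
  y₀ : MultiVertex J → ℝ
  L : EuclideanSpace ℝ (Fin D) →ₗ[ℝ] EuclideanSpace ℝ (Fin N) × (MultiVertex J → ℝ)
  injective : Function.Injective L
  mem_range : ∀ v, v ∈ LinearMap.range L ↔
    v.1 ∈ vectorSpan ℝ P ∧ ∀ i, A.b i v.1 = ∑ k, v.2 ⟨i, k⟩
  x₀_mem : x₀ ∈ P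
  sum_y₀ : ∀ i, A.c i + A.b i x₀ = ∑ k, y₀ ⟨i, k⟩

theorem FacetData.exists_blowUp {N m n : ℕ} {P : Set (EuclideanSpace ℝ (Fin N))}
    (A : FacetData m n P) (J : Fin m → ℕ+) : Nonempty (BlowUp A J (totalSize J - m + n)) := by
  obtain ⟨r, -, -, hr⟩ := exists_weights (J := J) ∅
  replace hr : ∀ i, ∑ k, r ⟨i, k⟩ = 1 := fun i => hr i ⟨⟨0, (J i).pos⟩, by simp⟩
  obtain ⟨x₀, hx₀, -⟩ := A.core
  let φ : (vectorSpan ℝ P × (MultiVertex J → ℝ)) →ₗ[ℝ] (Fin m → ℝ) :=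
    LinearMap.pi fun i =>
      ((A.b i : EuclideanSpace ℝ (Fin N) →ₗ[ℝ] ℝ) ∘ₗ (vectorSpan ℝ P).subtype) ∘ₗ
        LinearMap.fst ℝ _ _ - (∑ k, LinearMap.proj ⟨i, k⟩) ∘ₗ LinearMap.snd ℝ _ _
  have hφ : ∀ v i, φ v i = A.b i v.1 - ∑ k, v.2 ⟨i, k⟩ := fun v i => by
    simp [φ]
  -- Independence of the `m` equations: weights of sum one realize any right-hand side with
  -- `x`-component zero.
  have hsurj : LinearMap.range φ = ⊤ := by
    refine LinearMap.range_eq_top.2 fun f => ⟨(0, fun κ => -(f κ.1 * r κ)), ?_⟩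
    ext i
    rw [hφ]
    simp [← Finset.mul_sum, hr]
  have hrank : Module.finrank ℝ (LinearMap.ker φ) = totalSize J - m + n := by
    have h := φ.finrank_range_add_finrank_ker
    have hd := A.dim
    rw [polyDim] at hd
    rw [hsurj, finrank_top, Module.finrank_prod, Module.finrank_fin_fun,
      Module.finrank_fintype_fun_eq_card, hd, card_multiVertex] at h
    have := le_totalSize J
    omega
  let e : EuclideanSpace ℝ (Fin (totalSize J - m + n)) ≃ₗ[ℝ] LinearMap.ker φ :=
    LinearEquiv.ofFinrankEq _ _ (by rw [hrank, finrank_euclideanSpace_fin])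
  let ι : (vectorSpan ℝ P × (MultiVertex J → ℝ)) →ₗ[ℝ]
      EuclideanSpace ℝ (Fin N) × (MultiVertex J → ℝ) :=
    (vectorSpan ℝ P).subtype.prodMap LinearMap.id
  have hι : Function.Injective ι := by
    rintro ⟨a, b⟩ ⟨a', b'⟩ h
    simpa [ι] using h
  refine ⟨⟨x₀, fun κ => (A.c κ.1 + A.b κ.1 x₀) * r κ,
    ι ∘ₗ (LinearMap.ker φ).subtype ∘ₗ e.toLinearMap,
    hι.comp (Subtype.val_injective.comp e.injective), fun v => ⟨?_, ?_⟩, hx₀, fun i => ?_⟩⟩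
  · rintro ⟨z, rfl⟩
    refine ⟨(e z).1.1.2, fun i => ?_⟩
    have h := congrFun (LinearMap.mem_ker.1 (e z).2) i
    rw [hφ] at h
    exact sub_eq_zero.1 h
  · rintro ⟨h1, h2⟩
    have hmem : ((⟨v.1, h1⟩, v.2) : vectorSpan ℝ P × (MultiVertex J → ℝ)) ∈ LinearMap.ker φ := by
      rw [LinearMap.mem_ker]
      ext i
      rw [hφ, h2 i]
      simp
    refine ⟨e.symm ⟨_, hmem⟩, ?_⟩
    simp [ι]
  · simp [← Finset.mul_sum, hr]

/-! ### The body `P(J)`: lifts, compactness, dimension and facets -/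

namespace BlowUp

variable {N m n D : ℕ} {P : Set (EuclideanSpace ℝ (Fin N))} {A : FacetData m n P}
  {J : Fin m → ℕ+} (B : BlowUp A J D)

def X (z : EuclideanSpace ℝ (Fin D)) : EuclideanSpace ℝ (Fin N) := B.x₀ + (B.L z).1

def Y (z : EuclideanSpace ℝ (Fin D)) (κ : MultiVertex J) : ℝ := B.y₀ κ + (B.L z).2 κ

/-- The polytope `P(J)` in the coordinates of the chart. -/
def body : Set (EuclideanSpace ℝ (Fin D)) := {z | B.X z ∈ P ∧ ∀ κ, 0 ≤ B.Y z κ}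

/-- The facet of `P(J)` belonging to the vertex `κ`. -/
def wall (κ : MultiVertex J) : Set (EuclideanSpace ℝ (Fin D)) := {z ∈ B.body | B.Y z κ = 0}

variable {B}

theorem X_add_smul (z v : EuclideanSpace ℝ (Fin D)) (t : ℝ) :
    B.X (z + t • v) = B.X z + t • (B.L v).1 := by
  simp [X, add_assoc]

theorem Y_add_smul (z v : EuclideanSpace ℝ (Fin D)) (t : ℝ) (κ : MultiVertex J) :
    B.Y (z + t • v) κ = B.Y z κ + t * (B.L v).2 κ := by
  simp [Y, add_assoc]

theorem L_sub_fst (z z' : EuclideanSpace ℝ (Fin D)) : (B.L (z - z')).1 = B.X z - B.X z' := by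
  simp [X]

theorem L_sub_snd (z z' : EuclideanSpace ℝ (Fin D)) (κ : MultiVertex J) :
    (B.L (z - z')).2 κ = B.Y z κ - B.Y z' κ := by
  simp [Y]

theorem X_combo {α β : ℝ} (h : α + β = 1) (z z' : EuclideanSpace ℝ (Fin D)) :
    B.X (α • z + β • z') = α • B.X z + β • B.X z' := by
  obtain rfl : β = 1 - α := by linarith
  simp only [X, map_add, map_smul, Prod.fst_add, Prod.smul_fst]
  module

theorem Y_combo {α β : ℝ} (h : α + β = 1) (z z' : EuclideanSpace ℝ (Fin D)) (κ : MultiVertex J) :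
    B.Y (α • z + β • z') κ = α * B.Y z κ + β * B.Y z' κ := by
  obtain rfl : β = 1 - α := by linarith
  simp only [Y, map_add, map_smul, Prod.snd_add, Prod.smul_snd, Pi.add_apply, Pi.smul_apply,
    smul_eq_mul]
  ring

theorem ext_coord {z z' : EuclideanSpace ℝ (Fin D)} (hX : B.X z = B.X z')
    (hY : ∀ κ, B.Y z κ = B.Y z' κ) : z = z' := by
  refine B.injective (Prod.ext (add_left_cancel hX) (funext fun κ => add_left_cancel (hY κ)))

theorem sum_Y (z : EuclideanSpace ℝ (Fin D)) (i : Fin m) :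
    A.c i + A.b i (B.X z) = ∑ k, B.Y z ⟨i, k⟩ := by
  have h := ((B.mem_range (B.L z)).1 ⟨z, rfl⟩).2 i
  simp only [X, Y, map_add, Finset.sum_add_distrib, ← B.sum_y₀ i, ← h]
  ring

theorem exists_coord {x : EuclideanSpace ℝ (Fin N)} (hx : x ∈ P) {y : MultiVertex J → ℝ}
    (hy : ∀ i, A.c i + A.b i x = ∑ k, y ⟨i, k⟩) : ∃ z, B.X z = x ∧ ∀ κ, B.Y z κ = y κ := by
  have hmem : (x - B.x₀, y - B.y₀) ∈ LinearMap.range B.L := by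
    refine (B.mem_range _).2 ⟨vsub_mem_vectorSpan ℝ hx B.x₀_mem, fun i => ?_⟩
    simp only [map_sub, Pi.sub_apply, Finset.sum_sub_distrib, ← hy i, ← B.sum_y₀ i]
    ring
  obtain ⟨z, hz⟩ := hmem
  exact ⟨z, by simp [X, hz], fun κ => by simp [Y, hz]⟩

theorem nonneg_X {z : EuclideanSpace ℝ (Fin D)} (hz : z ∈ B.body) (i : Fin m) :
    0 ≤ A.c i + A.b i (B.X z) := A.nonneg i _ hz.1

theorem Y_le {z : EuclideanSpace ℝ (Fin D)} (hz : z ∈ B.body) (κ : MultiVertex J) :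
    B.Y z κ ≤ A.c κ.1 + A.b κ.1 (B.X z) := by
  rw [sum_Y]
  exact Finset.single_le_sum (f := fun k => B.Y z ⟨κ.1, k⟩) (fun k _ => hz.2 _)
    (Finset.mem_univ κ.2)

/-- A point of `P` lifts to a point of `P(J)` that lies in the walls of `σ` and in no further ones,
except where this is forced. -/
theorem exists_lift (B : BlowUp A J D) (σ : Finset (MultiVertex J)) :
    ∃ r : MultiVertex J → ℝ, (∀ κ ∈ σ, r κ = 0) ∧ (∀ κ ∉ σ, 0 < r κ) ∧
      ∀ x ∈ P, (∀ i, (∀ k, ⟨i, k⟩ ∈ σ) → A.c i + A.b i x = 0) →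
        ∃ z ∈ B.body, B.X z = x ∧ ∀ κ, B.Y z κ = (A.c κ.1 + A.b κ.1 x) * r κ := by
  obtain ⟨r, h0, hpos, hsum⟩ := exists_weights σ
  have hr : ∀ κ, 0 ≤ r κ := fun κ => by
    by_cases h : κ ∈ σ
    exacts [(h0 κ h).ge, (hpos κ h).le]
  refine ⟨r, h0, hpos, fun x hx hσ => ?_⟩
  obtain ⟨z, hzX, hzY⟩ := exists_coord (B := B) hx
    (y := fun κ => (A.c κ.1 + A.b κ.1 x) * r κ) fun i => by
      dsimp only
      rw [← Finset.mul_sum]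
      by_cases h : ∀ k, ⟨i, k⟩ ∈ σ
      · rw [hσ i h, zero_mul]
      · rw [hsum i (not_forall.1 h), mul_one]
  refine ⟨z, ⟨hzX ▸ hx, fun κ => ?_⟩, hzX, hzY⟩
  rw [hzY]
  exact mul_nonneg (A.nonneg _ x hx) (hr κ)

theorem exists_simple_lift (B : BlowUp A J D) :
    ∃ r : MultiVertex J → ℝ, (∀ κ, 0 < r κ) ∧
      ∀ x ∈ P, ∃ z ∈ B.body, B.X z = x ∧ ∀ κ, B.Y z κ = (A.c κ.1 + A.b κ.1 x) * r κ := by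
  obtain ⟨r, -, hpos, hlift⟩ := B.exists_lift ∅
  exact ⟨r, fun κ => hpos κ (Finset.notMem_empty κ), fun x hx => hlift x hx fun i h =>
    absurd (h ⟨0, (J i).pos⟩) (Finset.notMem_empty _)⟩

theorem convex_body : Convex ℝ B.body := by
  intro z hz z' hz' α β hα hβ h
  refine ⟨?_, fun κ => ?_⟩
  · rw [X_combo h]
    exact A.convex hz.1 hz'.1 hα hβ h
  · rw [Y_combo h]
    exact add_nonneg (mul_nonneg hα (hz.2 κ)) (mul_nonneg hβ (hz'.2 κ))

theorem isCompact_body : IsCompact B.body := by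
  choose M hM using fun i => A.isCompact.exists_bound_of_continuousOn (A.b i).continuous.continuousOn
  have hemb : IsClosedEmbedding fun z => (B.x₀, B.y₀) + B.L z :=
    (Homeomorph.addLeft (B.x₀, B.y₀)).isClosedEmbedding.comp
      (LinearMap.isClosedEmbedding_of_injective (LinearMap.ker_eq_bot.2 B.injective))
  -- Each `y`-coordinate is at most `a i x`, which is bounded on `P`, so a compact box already
  -- captures the body.
  have heq : B.body = (fun z => (B.x₀, B.y₀) + B.L z) ⁻¹'
      (P ×ˢ Set.univ.pi fun κ => Set.Icc 0 (A.c κ.1 + M κ.1)) := by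
    ext z
    constructor
    · refine fun hz => ⟨hz.1, fun κ _ => ⟨hz.2 κ, (Y_le hz κ).trans ?_⟩⟩
      linarith [le_abs_self (A.b κ.1 (B.X z)), hM κ.1 _ hz.1, Real.norm_eq_abs (A.b κ.1 (B.X z))]
    · exact fun hz => ⟨hz.1, fun κ => (hz.2 κ trivial).1⟩
  rw [heq]
  exact hemb.isCompact_preimage (A.isCompact.prod (isCompact_univ_pi fun _ => isCompact_Icc))

/-- Only the vanishing coordinates restrict the direction on the `y` side: positive ones survive a
short move. -/
theorem eventually_mem_body {z v : EuclideanSpace ℝ (Fin D)}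
    (hX : ∀ᶠ t : ℝ in 𝓝[>] 0, B.X z + t • (B.L v).1 ∈ P)
    (hY : ∀ κ, 0 < B.Y z κ ∨ B.Y z κ = 0 ∧ (B.L v).2 κ = 0) :
    ∀ᶠ t : ℝ in 𝓝[>] 0, z + t • v ∈ B.body := by
  have h : ∀ κ, ∀ᶠ t : ℝ in 𝓝[>] 0, 0 ≤ B.Y z κ + t * (B.L v).2 κ := fun κ => by
    rcases hY κ with h | ⟨h1, h2⟩
    · exact eventually_nonneg_add_mul h _
    · simp [h1, h2]
  filter_upwards [hX, eventually_all.2 h] with t h1 h2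
  exact ⟨by rwa [X_add_smul], fun κ => by rw [Y_add_smul]; exact h2 κ⟩

theorem exists_core (B : BlowUp A J D) : ∃ z ∈ B.body, (∀ κ, 0 < B.Y z κ) ∧
    ∀ v, ∀ᶠ t : ℝ in 𝓝[>] 0, z + t • v ∈ B.body := by
  obtain ⟨x, hx, hpos, hcore⟩ := A.core
  obtain ⟨r, hr, hlift⟩ := B.exists_simple_lift
  obtain ⟨z, hz, rfl, hzY⟩ := hlift x hx
  have hYpos : ∀ κ, 0 < B.Y z κ := fun κ => by
    rw [hzY]
    exact mul_pos (hpos _) (hr κ)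
  exact ⟨z, hz, hYpos, fun v => eventually_mem_body
    (hcore _ ((B.mem_range (B.L v)).1 ⟨v, rfl⟩).1) fun κ => Or.inl (hYpos κ)⟩

theorem exists_wall_core (B : BlowUp A J D) (κ : MultiVertex J) :
    ∃ z ∈ B.body, B.Y z κ = 0 ∧ (∀ κ' ≠ κ, 0 < B.Y z κ') ∧
      ∀ v, (B.L v).2 κ = 0 → ∀ᶠ t : ℝ in 𝓝[>] 0, z + t • v ∈ B.wall κ := by
  obtain ⟨x, hx, hσ, hpos, hcore⟩ : ∃ x ∈ P,
      (∀ i, (∀ k, (⟨i, k⟩ : MultiVertex J) ∈ ({κ} : Finset _)) → A.c i + A.b i x = 0) ∧ (∀ κ' ≠ κ, 0 < A.c κ'.1 + A.b κ'.1 x) ∧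
      ∀ v, (B.L v).2 κ = 0 → ∀ᶠ t : ℝ in 𝓝[>] 0, x + t • (B.L v).1 ∈ P := by
    obtain ⟨i, k⟩ := κ
    -- If `k` is the only copy of `i`, the wall forces `a i x = 0`, so `x` comes from the core of
    -- facet `i`; otherwise another copy absorbs `a i x` and `x` comes from the core of `P`.
    by_cases hk : ∀ k', k' = k
    · obtain ⟨x, hx, hx0, hxpos, hcore⟩ := A.facet_core i
      refine ⟨x, hx, fun j hj => ?_, fun κ' hκ' => hxpos _ ?_, fun v hv => ?_⟩
      · have := congrArg Sigma.fst (Finset.mem_singleton.1 (hj ⟨0, (J j).pos⟩))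
        simp only at this
        rwa [this]
      · obtain ⟨j, k'⟩ := κ'
        rintro rfl
        exact hκ' (by rw [hk k'])
      · obtain ⟨h1, h2⟩ := (B.mem_range (B.L v)).1 ⟨v, rfl⟩
        refine hcore _ h1 ?_
        rw [h2 i]
        exact Finset.sum_eq_zero fun k' _ => by rw [hk k', hv]
    · obtain ⟨x, hx, hxpos, hcore⟩ := A.core
      refine ⟨x, hx, fun j hj => absurd (fun k' => ?_) hk, fun κ' _ => hxpos _,
        fun v _ => hcore _ ((B.mem_range (B.L v)).1 ⟨v, rfl⟩).1⟩
      have := congrArg Sigma.fst (Finset.mem_singleton.1 (hj ⟨0, (J j).pos⟩))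
      simp only at this
      subst this
      simpa using hj k'
  obtain ⟨r, hr0, hr, hlift⟩ := B.exists_lift {κ}
  obtain ⟨z, hz, rfl, hzY⟩ := hlift x hx hσ
  have hz0 : B.Y z κ = 0 := by rw [hzY, hr0 κ (Finset.mem_singleton_self κ), mul_zero]
  have hzpos : ∀ κ' ≠ κ, 0 < B.Y z κ' := fun κ' h => by
    rw [hzY]
    exact mul_pos (hpos κ' h) (hr κ' (by simpa using h))
  refine ⟨z, hz, hz0, hzpos, fun v hv => ?_⟩
  refine (eventually_mem_body (hcore v hv) fun κ' => ?_).mono fun t ht => ⟨ht, ?_⟩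
  · by_cases h : κ' = κ
    · exact Or.inr (h ▸ ⟨hz0, hv⟩)
    · exact Or.inl (hzpos κ' h)
  · rw [Y_add_smul, hz0, hv, mul_zero, add_zero]

theorem polyDim_body : polyDim B.body = D := by
  obtain ⟨z, hz, -, hcore⟩ := B.exists_core
  have h : vectorSpan ℝ B.body = ⊤ :=
    eq_top_iff.2 fun v _ => mem_vectorSpan_of_eventually hz (hcore v)
  rw [polyDim, h, finrank_top, finrank_euclideanSpace_fin]

/-- The linear part of the coordinate `Y · κ`. -/
def wallFunctional (B : BlowUp A J D) (κ : MultiVertex J) : EuclideanSpace ℝ (Fin D) →ₗ[ℝ] ℝ :=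
  LinearMap.proj κ ∘ₗ LinearMap.snd ℝ _ _ ∘ₗ B.L

theorem Y_eq (z : EuclideanSpace ℝ (Fin D)) (κ : MultiVertex J) :
    B.Y z κ = B.y₀ κ + B.wallFunctional κ z := rfl

theorem polyDim_wall (κ : MultiVertex J) : polyDim (B.wall κ) + 1 = D := by
  obtain ⟨z, hz, hz0, -, hcore⟩ := B.exists_wall_core κ
  obtain ⟨z', -, hz', -⟩ := B.exists_core
  have h : vectorSpan ℝ (B.wall κ) = LinearMap.ker (B.wallFunctional κ) := by
    refine le_antisymm (fun v hv => ?_) fun v hv => ?_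
    · refine map_eq_zero_of_mem_vectorSpan (c := -B.y₀ κ) (fun w hw => ?_) hv
      linarith [hw.2, B.Y_eq w κ]
    · exact mem_vectorSpan_of_eventually (z := z) ⟨hz, hz0⟩ (hcore v hv)
  have hne : B.wallFunctional κ ≠ 0 := fun h0 => by
    have h1 := B.Y_eq z κ
    have h2 := B.Y_eq z' κ
    have h3 := hz' κ
    rw [h0, LinearMap.zero_apply] at h1 h2
    linarith
  rw [polyDim, h, Module.Dual.finrank_ker_add_one_of_ne_zero hne, finrank_euclideanSpace_fin]

theorem isFacet_wall (κ : MultiVertex J) : IsFacet B.body (B.wall κ) := by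
  obtain ⟨z, hz, hz0, -⟩ := B.exists_wall_core κ
  refine ⟨⟨z, hz, hz0⟩, fun _ => ⟨LinearMap.toContinuousLinearMap (-B.wallFunctional κ), ?_⟩,
    by rw [polyDim_wall, polyDim_body]⟩
  ext w
  refine and_congr_right fun hw => ⟨fun h w' hw' => ?_, fun h => ?_⟩
  · have := hw'.2 κ
    simp only [Y_eq, LinearMap.coe_toContinuousLinearMap', LinearMap.neg_apply] at h this ⊢
    linarith
  · have h1 := h z hz
    have h2 := hw.2 κ
    simp only [Y_eq, LinearMap.coe_toContinuousLinearMap', LinearMap.neg_apply] at hz0 h1 h2 ⊢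
    linarith

theorem wall_injective : Function.Injective B.wall := by
  intro κ κ' h
  obtain ⟨z, hz, hz0, hpos, -⟩ := B.exists_wall_core κ
  by_contra hne
  have hmem : z ∈ B.wall κ' := h ▸ ⟨hz, hz0⟩
  exact (hpos κ' (Ne.symm hne)).ne' hmem.2

/-- With all coordinates positive, a move that fixes `x` is feasible in both directions, so `l`
vanishes on it and factors through `B.X`. The induced functional on `P` is maximal at a point off
all facets, and `A.support` applies. -/
theorem map_eq_of_forall_pos {z : EuclideanSpace ℝ (Fin D)} (hz : z ∈ B.body)
    (hpos : ∀ κ, 0 < B.Y z κ) {l : EuclideanSpace ℝ (Fin D) →ₗ[ℝ] ℝ}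
    (hl : ∀ q ∈ B.body, l q ≤ l z) : ∀ q ∈ B.body, l q = l z := by
  have hvert : ∀ v, (B.L v).1 = 0 → l v ≤ 0 := fun v hv => by
    obtain ⟨t, ht, ht0⟩ := ((eventually_mem_body (v := v) (z := z) (B := B)
      (by simp [hv, hz.1]) fun κ => Or.inl (hpos κ)).and self_mem_nhdsWithin).exists
    have h := hl _ ht
    rw [map_add, map_smul, smul_eq_mul] at h
    exact nonpos_of_mul_nonpos_right (by linarith) (show 0 < t from ht0)
  have hfib : ∀ q q', B.X q = B.X q' → l q = l q' := fun q q' h => by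
    have h1 := hvert (q - q') (by rw [L_sub_fst, h, sub_self])
    have h2 := hvert (q' - q) (by rw [L_sub_fst, h, sub_self])
    rw [map_sub] at h1 h2
    linarith
  obtain ⟨r, -, hlift⟩ := B.exists_simple_lift
  obtain ⟨g, hg⟩ := B.L.exists_leftInverse_of_injective (LinearMap.ker_eq_bot.2 B.injective)
  -- `f` is the linear part of the lift `x ↦ (x, a i x * r)`, and `g` returns to the chart, so `l ∘ₗ
  -- g ∘ₗ f` is the induced functional.
  let f : EuclideanSpace ℝ (Fin N) →ₗ[ℝ] EuclideanSpace ℝ (Fin N) × (MultiVertex J → ℝ) :=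
    LinearMap.id.prod (LinearMap.pi fun κ => r κ • (A.b κ.1 : EuclideanSpace ℝ (Fin N) →ₗ[ℝ] ℝ))
  have key : ∀ q ∈ B.body, l q - l z = (l ∘ₗ g ∘ₗ f) (B.X q) - (l ∘ₗ g ∘ₗ f) (B.X z) := by
    intro q hq
    obtain ⟨q', -, hX, hY⟩ := hlift _ hq.1
    obtain ⟨z', -, hX', hY'⟩ := hlift _ hz.1
    have hL : f (B.X q - B.X z) = B.L (q' - z') := by
      refine Prod.ext ?_ (funext fun κ => ?_)
      · rw [L_sub_fst, hX, hX']
        rfl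
      · rw [L_sub_snd, hY, hY']
        rw [show (f (B.X q - B.X z)).2 κ = r κ * A.b κ.1 (B.X q - B.X z) from rfl, map_sub]
        ring
    rw [← hfib _ _ hX, ← hfib _ _ hX', ← map_sub, ← map_sub, LinearMap.comp_apply,
      LinearMap.comp_apply, hL]
    exact congrArg l (LinearMap.congr_fun hg (q' - z')).symm
  have hx : ∀ i, 0 < A.c i + A.b i (B.X z) := fun i => by
    rw [sum_Y]
    exact Finset.sum_pos (fun k _ => hpos _) ⟨⟨0, (J i).pos⟩, Finset.mem_univ _⟩
  have hmax : ∀ p ∈ P, (l ∘ₗ g ∘ₗ f) p ≤ (l ∘ₗ g ∘ₗ f) (B.X z) := fun p hp => by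
    obtain ⟨q, hq, rfl, -⟩ := hlift p hp
    linarith [key q hq, hl q hq]
  intro q hq
  linarith [key q hq, A.support _ hz.1 hx _ hmax _ hq.1]

/-- A facet contained in no wall has, for each `κ`, a point with positive `κ`-coordinate; midpoints
combine these into one point with all coordinates positive. The functional exposing the facet is
then constant on the body. -/
theorem exists_eq_wall {F : Set (EuclideanSpace ℝ (Fin D))} (hF : IsFacet B.body F) :
    ∃ κ, B.wall κ = F := by
  by_contra! hne
  have hnot : ∀ κ, ∃ z ∈ F, 0 < B.Y z κ := fun κ => by
    by_contra! h
    exact hne κ (hF.eq_of_subset (isFacet_wall κ) fun z hz =>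
      ⟨hF.subset hz, (h z hz).antisymm ((hF.subset hz).2 κ)⟩).symm
  have hall : ∀ σ : Finset (MultiVertex J), ∃ z ∈ F, ∀ κ ∈ σ, 0 < B.Y z κ := fun σ => by
    induction σ using Finset.induction_on with
    | empty =>
      obtain ⟨z, hz⟩ := hF.1
      exact ⟨z, hz, by simp⟩
    | insert κ σ _ ih =>
      obtain ⟨z, hz, hpos⟩ := ih
      obtain ⟨z', hz', hpos'⟩ := hnot κ
      have h2 : (1 / 2 : ℝ) + 1 / 2 = 1 := by norm_num
      refine ⟨(1 / 2 : ℝ) • z + (1 / 2 : ℝ) • z', hF.2.1.convex convex_body hz hz' (by norm_num)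
        (by norm_num) h2, fun κ' hκ' => ?_⟩
      rw [Y_combo h2]
      have h3 := (hF.subset hz).2 κ'
      have h4 := (hF.subset hz').2 κ'
      rcases Finset.mem_insert.1 hκ' with rfl | h
      · linarith
      · linarith [hpos κ' h]
  obtain ⟨z, hz, hpos⟩ := hall Finset.univ
  obtain ⟨q, hq, hqF⟩ := hF.exists_notMem
  obtain ⟨b, c, hb, rfl⟩ := hF.exists_functional
  have h := map_eq_of_forall_pos (hF.subset hz) (fun κ => hpos κ (Finset.mem_univ κ))
    (l := -(b : EuclideanSpace ℝ (Fin D) →ₗ[ℝ] ℝ)) (fun q' hq' => by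
      simp only [LinearMap.neg_apply, ContinuousLinearMap.coe_coe]
      linarith [hb q' hq', hz.2]) q hq
  simp only [LinearMap.neg_apply, ContinuousLinearMap.coe_coe] at h
  exact hqF ⟨hq, by linarith [hz.2]⟩

/-- The walls of `P(J)` are its facets. -/
noncomputable def wallEquiv (B : BlowUp A J D) : MultiVertex J ≃ facets B.body :=
  Equiv.ofBijective (fun κ => ⟨B.wall κ, isFacet_wall κ⟩)
    ⟨fun _ _ h => wall_injective (congrArg Subtype.val h), fun F => by
      obtain ⟨κ, hκ⟩ := exists_eq_wall F.2
      exact ⟨κ, Subtype.ext hκ⟩⟩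

end BlowUp

/-! ### Extreme points, simplicity and intersections of walls -/

namespace BlowUp

variable {N m n D : ℕ} {P : Set (EuclideanSpace ℝ (Fin N))} {A : FacetData m n P}
  {J : Fin m → ℕ+} {B : BlowUp A J D}

theorem Y_eq_zero_of_X {z : EuclideanSpace ℝ (Fin D)} (hz : z ∈ B.body) {κ : MultiVertex J}
    (h : A.c κ.1 + A.b κ.1 (B.X z) = 0) : B.Y z κ = 0 :=
  (h ▸ Y_le hz κ).antisymm (hz.2 κ)

theorem X_mem_extremePoints {z : EuclideanSpace ℝ (Fin D)}
    (hz : z ∈ Set.extremePoints ℝ B.body) : B.X z ∈ Set.extremePoints ℝ P := by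
  refine mem_extremePoints_iff_left.2 ⟨hz.1.1, ?_⟩
  rintro x₁ hx₁ x₂ hx₂ ⟨α, β, hα, hβ, hαβ, hx⟩
  have ha : ∀ i, A.c i + A.b i (B.X z) =
      α * (A.c i + A.b i x₁) + β * (A.c i + A.b i x₂) := fun i => by
    obtain rfl : β = 1 - α := by linarith
    rw [← hx]
    simp only [map_add, map_smul, smul_eq_mul]
    ring
  -- A segment in `P` through `B.X z` lifts to one through `z` by rescaling each group of copies
  -- proportionally to `a i`. Where `a i` vanishes at `B.X z`, division by zero gives the correct
  -- value `0`.
  have hsplit : ∀ x ∈ P, (∀ i, A.c i + A.b i (B.X z) = 0 → A.c i + A.b i x = 0) →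
      ∃ z' ∈ B.body, B.X z' = x ∧ ∀ κ, B.Y z' κ =
        B.Y z κ * ((A.c κ.1 + A.b κ.1 x) / (A.c κ.1 + A.b κ.1 (B.X z))) := by
    intro x hx h
    obtain ⟨z', hX, hY⟩ := exists_coord (B := B) hx (y := fun κ =>
      B.Y z κ * ((A.c κ.1 + A.b κ.1 x) / (A.c κ.1 + A.b κ.1 (B.X z)))) fun i => by
        dsimp only
        rw [← Finset.sum_mul, ← sum_Y]
        by_cases h0 : A.c i + A.b i (B.X z) = 0
        · rw [h i h0, h0, zero_mul]
        · rw [mul_div_cancel₀ _ h0]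
    refine ⟨z', ⟨hX ▸ hx, fun κ => ?_⟩, hX, hY⟩
    rw [hY]
    exact mul_nonneg (hz.1.2 κ) (div_nonneg (A.nonneg _ _ hx) (nonneg_X hz.1 _))
  have hzero : ∀ i, A.c i + A.b i (B.X z) = 0 →
      A.c i + A.b i x₁ = 0 ∧ A.c i + A.b i x₂ = 0 := fun i h => by
    have h1 := mul_nonneg hα.le (A.nonneg i _ hx₁)
    have h2 := mul_nonneg hβ.le (A.nonneg i _ hx₂)
    have h3 := ha i
    exact ⟨(mul_eq_zero.1 (show α * (A.c i + A.b i x₁) = 0 by linarith)).resolve_left hα.ne',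
      (mul_eq_zero.1 (show β * (A.c i + A.b i x₂) = 0 by linarith)).resolve_left hβ.ne'⟩
  obtain ⟨z₁, hz₁, hX₁, hY₁⟩ := hsplit x₁ hx₁ fun i h => (hzero i h).1
  obtain ⟨z₂, hz₂, hX₂, hY₂⟩ := hsplit x₂ hx₂ fun i h => (hzero i h).2
  have heq : α • z₁ + β • z₂ = z := by
    refine ext_coord (B := B) (by rw [X_combo hαβ, hX₁, hX₂, hx]) fun κ => ?_
    rw [Y_combo hαβ, hY₁, hY₂]
    by_cases h0 : A.c κ.1 + A.b κ.1 (B.X z) = 0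
    · rw [Y_eq_zero_of_X hz.1 h0]
      ring
    · field_simp
      rw [ha κ.1]
  rw [← hX₁, hz.2 hz₁ hz₂ ⟨α, β, hα, hβ, hαβ, heq⟩]

/-- If two copies of `i` were positive, shifting mass between them either way would exhibit `z` as a
midpoint. -/
theorem eq_of_Y_ne_zero {z : EuclideanSpace ℝ (Fin D)} (hz : z ∈ Set.extremePoints ℝ B.body)
    {i : Fin m} {k k' : Fin (J i)} (hk : B.Y z ⟨i, k⟩ ≠ 0) (hk' : B.Y z ⟨i, k'⟩ ≠ 0) :
    k = k' := by
  by_contra hne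
  have hpos : 0 < B.Y z ⟨i, k⟩ := lt_of_le_of_ne (hz.1.2 _) hk.symm
  have hpos' : 0 < B.Y z ⟨i, k'⟩ := lt_of_le_of_ne (hz.1.2 _) hk'.symm
  have hκ : (⟨i, k⟩ : MultiVertex J) ≠ ⟨i, k'⟩ := fun h => hne (by simpa using h)
  obtain ⟨v, hv⟩ : ((0, Pi.single ⟨i, k⟩ 1 - Pi.single ⟨i, k'⟩ 1) :
      EuclideanSpace ℝ (Fin N) × (MultiVertex J → ℝ)) ∈ LinearMap.range B.L := by
    refine (B.mem_range _).2 ⟨Submodule.zero_mem _, fun j => ?_⟩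
    have hsum : ∀ k₀ : Fin (J i), ∑ l, (Pi.single ⟨i, k₀⟩ 1 : MultiVertex J → ℝ) ⟨j, l⟩ =
        if j = i then 1 else 0 := fun k₀ => by
      split_ifs with hj
      · subst hj
        rw [Finset.sum_eq_single k₀]
        · simp
        · exact fun l _ hl => Pi.single_eq_of_ne (fun h => hl (by simpa using h)) _
        · simp
      · exact Finset.sum_eq_zero fun l _ =>
          Pi.single_eq_of_ne (fun h => hj (congrArg Sigma.fst h)) _
    simp only [Pi.sub_apply, Finset.sum_sub_distrib, hsum, map_zero, sub_self]
  have hmem : ∀ ε : ℝ, ∀ᶠ t : ℝ in 𝓝[>] 0, z + t • (ε • v) ∈ B.body := by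
    intro ε
    refine eventually_mem_body (by simp [hv, hz.1.1]) fun κ => ?_
    by_cases h : κ = ⟨i, k⟩
    · exact Or.inl (h ▸ hpos)
    by_cases h' : κ = ⟨i, k'⟩
    · exact Or.inl (h' ▸ hpos')
    · rcases (hz.1.2 κ).lt_or_eq with h0 | h0
      · exact Or.inl h0
      · exact Or.inr ⟨h0.symm, by simp [hv, h, h']⟩
  obtain ⟨t, ⟨h1, h2⟩, ht⟩ :=
    (((hmem 1).and (hmem (-1))).and self_mem_nhdsWithin).exists
  have heq := hz.2 h1 h2 ⟨1 / 2, 1 / 2, by norm_num, by norm_num, by norm_num, by module⟩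
  have h3 := B.Y_add_smul z ((1 : ℝ) • v) t ⟨i, k⟩
  rw [heq, one_smul, hv] at h3
  exact (ne_of_gt ht) (by simpa [hκ] using h3)

theorem card_Y_eq_zero {z : EuclideanSpace ℝ (Fin D)} (hz : z ∈ Set.extremePoints ℝ B.body) :
    {κ | B.Y z κ = 0}.encard = (totalSize J - m + n : ℕ) := by
  classical
  have h1 := Finset.card_filter_add_card_filter_not (s := Finset.univ) fun κ => B.Y z κ = 0
  have h2 := Finset.card_filter_add_card_filter_not (s := Finset.univ)
    fun i => A.c i + A.b i (B.X z) = 0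
  have h3 : (Finset.univ.filter fun i => A.c i + A.b i (B.X z) = 0).card = n := by
    have h := A.card_extreme _ (X_mem_extremePoints hz)
    rw [← Finset.coe_filter_univ, Set.encard_coe_eq_coe_finsetCard] at h
    exact_mod_cast h
  -- Each `i` with `a i ≠ 0` at `B.X z` has exactly one nonzero copy, the others have none; hence `m
  -- - n` nonzero coordinates.
  have h4 : (Finset.univ.filter fun κ => ¬ B.Y z κ = 0).card =
      (Finset.univ.filter fun i => ¬ A.c i + A.b i (B.X z) = 0).card := by
    refine Finset.card_bij (fun κ _ => κ.1) (fun κ hκ => ?_) ?_ fun i hi => ?_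
    · simp only [Finset.mem_filter, Finset.mem_univ, true_and] at hκ ⊢
      exact fun h => hκ (Y_eq_zero_of_X hz.1 h)
    · rintro ⟨i, k⟩ hκ ⟨j, k'⟩ hκ' h
      simp only [Finset.mem_filter, Finset.mem_univ, true_and] at h hκ hκ'
      subst h
      rw [eq_of_Y_ne_zero hz hκ hκ']
    · simp only [Finset.mem_filter, Finset.mem_univ, true_and, sum_Y] at hi
      obtain ⟨k, -, hk⟩ := Finset.exists_ne_zero_of_sum_ne_zero hi
      exact ⟨⟨i, k⟩, by simpa using hk, rfl⟩
  rw [Finset.card_univ, card_multiVertex] at h1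
  rw [Finset.card_univ, Fintype.card_fin] at h2
  have h5 := le_totalSize J
  rw [← Finset.coe_filter_univ, Set.encard_coe_eq_coe_finsetCard]
  exact congrArg _ (by omega)

/-- The image in `P` and the set of nonzero coordinates determine an extreme point: a nonzero copy
of `i` carries the whole value `a i x`. -/
theorem finite_extremePoints_body : (Set.extremePoints ℝ B.body).Finite := by
  refine Set.Finite.of_injOn (f := fun z => (B.X z, {κ | B.Y z κ ≠ 0}))
    (t := Set.extremePoints ℝ P ×ˢ Set.univ)
    (fun z hz => ⟨X_mem_extremePoints hz, trivial⟩) ?_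
    (A.finite_extremePoints.prod Set.finite_univ)
  intro z hz z' hz' h
  obtain ⟨hX, hS⟩ := Prod.mk.inj h
  have hY : ∀ w ∈ Set.extremePoints ℝ B.body, ∀ κ, B.Y w κ ≠ 0 →
      B.Y w κ = A.c κ.1 + A.b κ.1 (B.X w) := fun w hw κ hκ => by
    rw [sum_Y, Finset.sum_eq_single κ.2]
    · intro k _ hk
      by_contra h0
      exact hk (eq_of_Y_ne_zero hw h0 hκ)
    · simp
  refine ext_coord hX fun κ => ?_
  have hiff : B.Y z κ ≠ 0 ↔ B.Y z' κ ≠ 0 := Set.ext_iff.1 hS κ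
  by_cases h0 : B.Y z κ = 0
  · rw [h0, not_not.1 (mt hiff.2 (not_not.2 h0))]
  · rw [hY z hz κ h0, hY z' hz' κ (hiff.1 h0), hX]

/-- Krein–Milman; the hull of finitely many extreme points is already closed. -/
theorem isPolytope_body : IsPolytope B.body := by
  have hfin := finite_extremePoints_body (B := B)
  have h := closure_convexHull_extremePoints B.isCompact_body B.convex_body
  rw [(hfin.isCompact_convexHull (𝕜 := ℝ)).isClosed.closure_eq] at h
  obtain ⟨z, hz, -⟩ := B.exists_core
  refine ⟨hfin.toFinset, ?_, by rw [hfin.coe_toFinset, h]⟩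
  rw [← Finset.coe_nonempty, hfin.coe_toFinset, ← convexHull_nonempty_iff (𝕜 := ℝ), h]
  exact ⟨z, hz⟩

theorem isSimplePolytope_body (hD : D = totalSize J - m + n) : IsSimplePolytope D B.body := by
  refine ⟨isPolytope_body, polyDim_body, fun z hz => ?_⟩
  refine Eq.trans ?_ ((card_Y_eq_zero hz).trans (congrArg _ hD.symm))
  symm
  refine Set.encard_congr (Equiv.ofBijective
    (fun κ => ⟨B.wall κ.1, isFacet_wall κ.1, hz.1, κ.2⟩) ⟨?_, ?_⟩)
  · intro κ κ' h
    exact Subtype.ext (wall_injective (congrArg (fun F => F.1) h))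
  · rintro ⟨F, hF, hzF⟩
    obtain ⟨κ, rfl⟩ := exists_eq_wall hF
    exact ⟨⟨κ, hzF.2⟩, rfl⟩

theorem encard_facets_body : (facets B.body).encard = totalSize J := by
  rw [← Set.encard_congr ((Equiv.Set.univ _).trans B.wallEquiv), Set.encard_univ,
    ENat.card_eq_coe_fintype_card, card_multiVertex]

theorem iInter_wall_nonempty_iff {σ : Finset (MultiVertex J)} (hσ : σ.Nonempty) :
    (⋂ κ ∈ σ, B.wall κ).Nonempty ↔
      ∃ x ∈ P, ∀ i, (∀ k, ⟨i, k⟩ ∈ σ) → A.c i + A.b i x = 0 := by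
  constructor
  · rintro ⟨z, hz⟩
    rw [Set.mem_iInter₂] at hz
    obtain ⟨κ, hκ⟩ := hσ
    refine ⟨B.X z, (hz κ hκ).1.1, fun i hi => ?_⟩
    rw [sum_Y]
    exact Finset.sum_eq_zero fun k _ => (hz _ (hi k)).2
  · rintro ⟨x, hx, h⟩
    obtain ⟨r, hr0, -, hlift⟩ := B.exists_lift σ
    obtain ⟨z, hz, -, hY⟩ := hlift x hx h
    exact ⟨z, Set.mem_iInter₂.2 fun κ hκ => ⟨hz, by rw [hY, hr0 κ hκ, mul_zero]⟩⟩

end BlowUp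

/-! ### Duality with `K(J)` -/

theorem mem_multiComplex_iff {m : ℕ} (K : AbstractSimplicialComplex (Fin m)) (J : Fin m → ℕ+)
    {σ : Finset (MultiVertex J)} (hσ : σ.Nonempty) {σ' : Finset (Fin m)}
    (hσ' : ∀ i, i ∈ σ' ↔ ∀ k, ⟨i, k⟩ ∈ σ) :
    σ ∈ multiComplex K J ↔ σ' = ∅ ∨ σ' ∈ K := by
  have hsub : ∀ τ, inflate J τ ⊆ σ ↔ τ ⊆ σ' := fun τ => by
    constructor
    · exact fun h i hi => (hσ' i).2 fun k => h (by simp [inflate, hi])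
    · rintro h ⟨i, k⟩ hκ
      exact (hσ' i).1 (h (by simpa [inflate] using hκ)) k
  have hdef : σ ∈ multiComplex K J ↔ σ.Nonempty ∧ ∀ τ, IsMinimalNonface K τ → ¬ inflate J τ ⊆ σ :=
    Iff.rfl
  rw [hdef, mem_iff_no_minimalNonface K σ']
  simp only [hsub, hσ, true_and]
  constructor
  · exact fun h => σ'.eq_empty_or_nonempty.imp_right fun hne => ⟨hne, h⟩
  · rintro (rfl | h)
    · exact fun τ hτ h => hτ.1.ne_empty (Finset.subset_empty.1 h)
    · exact h.2

theorem mainTheorem6 {N n m : ℕ} (K : AbstractSimplicialComplex (Fin m)) (J : Fin m → ℕ+)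
    (P : Set (EuclideanSpace ℝ (Fin N))) (hP : IsSimplePolytope n P)
    (hm : (facets P).encard = m) (hK : IsDualTo K P) :
    ∃ PJ : Set (EuclideanSpace ℝ (Fin (totalSize J - m + n))),
      IsSimplePolytope (totalSize J - m + n) PJ ∧
      (facets PJ).encard = totalSize J ∧
      IsDualTo (multiComplex K J) PJ := by
  obtain ⟨Φ, hΦ⟩ := hK
  obtain ⟨A, hA⟩ := hP.exists_facetData Φ
  obtain ⟨B⟩ := A.exists_blowUp J
  refine ⟨B.body, BlowUp.isSimplePolytope_body rfl, BlowUp.encard_facets_body, B.wallEquiv,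
    fun σ hσ => ?_⟩
  let σ' : Finset (Fin m) := Finset.univ.filter fun i => ∀ k, (⟨i, k⟩ : MultiVertex J) ∈ σ
  have hσ' : ∀ i, i ∈ σ' ↔ ∀ k, (⟨i, k⟩ : MultiVertex J) ∈ σ := fun i => by simp [σ']
  refine (mem_multiComplex_iff K J hσ hσ').trans (Iff.trans ?_
    (BlowUp.iInter_wall_nonempty_iff (B := B) hσ).symm)
  simp only [← hσ']
  -- The empty set is not a face of `K`, so it needs its own case: no facet condition remains, and
  -- any point of `P` serves.
  rcases σ'.eq_empty_or_nonempty with h | h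
  · obtain ⟨x, hx, -⟩ := A.core
    simp only [h, true_or, true_iff]
    exact ⟨x, hx, by simp⟩
  · rw [hΦ σ' h, or_iff_right h.ne_empty]
    constructor
    · rintro ⟨x, hx⟩
      simp only [hA, Set.mem_iInter] at hx
      obtain ⟨i, hi⟩ := h
      exact ⟨x, (hx i hi).1, fun j hj => (hx j hj).2⟩
    · rintro ⟨x, hx, h0⟩
      refine ⟨x, ?_⟩
      simp only [hA, Set.mem_iInter]
      exact fun i hi => ⟨hx, h0 i hi⟩
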